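/- Let $d\in\mathbb N$, let $W=C_0([0,1],\mathbb R^d)$ be the space of continuous paths $w:[0,1]\to\mathbb R^d$ with $w(0)=0$, let $\mu$ be the Wiener measure on $W$ (the law of standard $d$-dimensional Brownian motion), with expectation $E$, and let $H$ be the Cameron–Martin space of paths $h(t)=\int_0^t\dot h(s)\,ds$ with $\dot h\in L^2([0,1],\mathbb R^d)$ and $|h|_H=|\dot h|_{L^2}$. A function $F:W\to\mathbb R$ is called cylindrical if $F(w)=f(w(t_1),\dots,w(t_n))$ for some $n$, some $t_1,\dots,t_n\in[0,1]$ and some Schwartz function $f$ on $(\mathbb R^d)^n$; its gradient $\nabla F:W\to H$ is determined by $(\nabla F(w),h)_H=\frac{d}{dr}F(w+rh)\big|_{r=0}$ for all $h\in H$. The space $\mathbb D_{2,1}$ consists of the $\varphi\in L^2(\mu)$ for which there are cylindrical $F_n$ with $F_n\to\varphi$ in $L^2(\mu)$ and $(\nabla F_n)$ convergent in $L^2(\mu;H)$, and $\nabla\varphi:=\lim_n\nabla F_n$. Theorem (logarithmic Sobolev inequality). For every $\varphi\in\mathbb D_{2,1}$, the random variable $\varphi^2\log\varphi^2$ is $\mu$-integrable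 (with $0\log 0=0$) and $$E[\varphi^2\log\varphi^2]\le E[\varphi^2]\,\log E[\varphi^2]+2\,E\big[|\nabla\varphi|_H^2\big].$$ -/

import Mathlib

open MeasureTheory ProbabilityTheory Filter Topology
open scoped unitInterval ENNReal SchwartzMap

/-- The classical Wiener space `C₀([0,1], ℝᵈ)`: continuous paths `w : [0,1] → ℝᵈ` with
`w 0 = 0`, with the supremum norm inherited from `C([0,1], ℝᵈ)`. -/
def WienerSpace (d : ℕ) : Submodule ℝ C(I, EuclideanSpace ℝ (Fin d)) where
  carrier := {w | w 0 = 0}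
  add_mem' {v w} hv hw := by
    have hv' : v 0 = 0 := hv
    have hw' : w 0 = 0 := hw
    simp [hv', hw']
  zero_mem' := by simp
  smul_mem' c w hw := by
    have hw' : w 0 = 0 := hw
    simp [hw']

/-- The Borel σ-algebra of the Wiener space. -/
instance WienerSpace.instMeasurableSpace (d : ℕ) : MeasurableSpace (WienerSpace d) :=
  borel (WienerSpace d)

instance WienerSpace.instBorelSpace (d : ℕ) : BorelSpace (WienerSpace d) := ⟨rfl⟩

/-- `μ` is the (standard) Wiener measure on `C₀([0,1], ℝᵈ)`: under `μ` the coordinate process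
`(t, i) ↦ Wᵢ(t)` is a centred Gaussian process with
`E[Wᵢ(s) Wⱼ(t)] = δᵢⱼ min(s, t)`. (In particular `μ` is a probability measure, and these
conditions determine `μ` uniquely.) -/
structure IsWienerMeasure {d : ℕ} (μ : Measure (WienerSpace d)) : Prop where
  isGaussianProcess :
    IsGaussianProcess (fun (q : I × Fin d) (w : WienerSpace d) ↦ w.1 q.1 q.2) μ
  integral_eval : ∀ (t : I) (i : Fin d), ∫ w : WienerSpace d, w.1 t i ∂μ = 0
  covariance_eval : ∀ (s t : I) (i j : Fin d),
    cov[fun w : WienerSpace d ↦ w.1 s i, fun w : WienerSpace d ↦ w.1 t j; μ] =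
      if i = j then ((min s t : I) : ℝ) else 0

/-- The Cameron–Martin space `H`. An element `h` is represented by its density
`ḣ ∈ L²([0,1], ℝᵈ)`, with the norm `|h|_H = |ḣ|_{L²}`; the path `h(t) = ∫₀ᵗ ḣ(s) ds` itself
is `CameronMartin.path h`. -/
abbrev CameronMartin (d : ℕ) : Type :=
  Lp (EuclideanSpace ℝ (Fin d)) 2 (volume : Measure I)

theorem CameronMartin.integrable {d : ℕ} (h : CameronMartin d) :
    Integrable (fun s : I ↦ h s) :=
  (Lp.memLp h).integrable (by norm_num)

theorem CameronMartin.continuous_primitive {d : ℕ} (h : CameronMartin d) :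
    Continuous fun t : I ↦ ∫ s in Set.Iic t, h s := by
  simp_rw [← integral_indicator measurableSet_Iic]
  refine continuous_iff_continuousAt.2 fun t₀ ↦ ?_
  refine continuousAt_of_dominated (bound := fun s ↦ ‖h s‖)
    (.of_forall fun t ↦ h.integrable.aestronglyMeasurable.indicator measurableSet_Iic)
    (.of_forall fun t ↦ .of_forall fun s ↦ norm_indicator_le_norm_self _ s)
    h.integrable.norm ?_
  have hne : ∀ᵐ s : I, s ≠ t₀ := by simp [ae_iff]
  filter_upwards [hne] with s hs
  rcases lt_or_gt_of_ne hs with hlt | hgt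
  · refine (continuousAt_const (y := h s)).congr ?_
    filter_upwards [lt_mem_nhds hlt] with t ht
    simp [Set.indicator, ht.le]
  · refine (continuousAt_const (y := 0)).congr ?_
    filter_upwards [gt_mem_nhds hgt] with t ht
    simp [Set.indicator, not_le.2 ht]

/-- The path `t ↦ ∫₀ᵗ ḣ(s) ds` of an element of the Cameron–Martin space. -/
noncomputable def CameronMartin.path {d : ℕ} (h : CameronMartin d) : WienerSpace d :=
  ⟨⟨fun t : I ↦ ∫ s in Set.Iic t, h s, h.continuous_primitive⟩, by
    have h0 : Set.Iic (0 : I) = {0} := by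
      ext s
      exact ⟨fun hs ↦ le_antisymm hs unitInterval.nonneg', fun hs ↦ le_of_eq hs⟩
    change ∫ s in Set.Iic (0 : I), h s = 0
    rw [h0, Measure.restrict_singleton]
    simp⟩

/-- Smooth cylindrical functions `F(w) = f(w(t₁), …, w(tₙ))` with `f` a Schwartz function. -/
def IsCylindrical {d : ℕ} (F : WienerSpace d → ℝ) : Prop :=
  ∃ (n : ℕ) (t : Fin n → I) (f : 𝓢(Fin n → EuclideanSpace ℝ (Fin d), ℝ)),
    ∀ w : WienerSpace d, F w = f fun k ↦ w.1 (t k)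

/-- `D : W → H` is the gradient of `F` along the Cameron–Martin space:
`d/dr F(w + r h)|_{r = 0} = (D w, h)_H` for all `w ∈ W` and `h ∈ H`. -/
def IsCameronMartinGradient {d : ℕ} (F : WienerSpace d → ℝ)
    (D : WienerSpace d → CameronMartin d) : Prop :=
  ∀ (w : WienerSpace d) (h : CameronMartin d),
    HasDerivAt (fun r : ℝ ↦ F (w + r • h.path)) (inner ℝ (D w) h) 0

/-- `D` is (a version of) the Gross–Sobolev derivative `∇φ` in `Lᵖ(μ)`: there are cylindrical
functions `Fₙ` with `Fₙ → φ` in `Lᵖ(μ)` and `∇Fₙ → D` in `Lᵖ(μ; H)`. -/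
def IsGrossSobolevDeriv {d : ℕ} (p : ℝ≥0∞) (μ : Measure (WienerSpace d))
    (φ : WienerSpace d → ℝ) (D : WienerSpace d → CameronMartin d) : Prop :=
  MemLp φ p μ ∧ MemLp D p μ ∧
    ∃ (F : ℕ → WienerSpace d → ℝ) (DF : ℕ → WienerSpace d → CameronMartin d),
      (∀ n, IsCylindrical (F n)) ∧ (∀ n, IsCameronMartinGradient (F n) (DF n)) ∧
      Tendsto (fun n ↦ eLpNorm (F n - φ) p μ) atTop (𝓝 0) ∧
      Tendsto (fun n ↦ eLpNorm (DF n - D) p μ) atTop (𝓝 0)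

/-- The space `𝔻_{p,1}`: the domain of the closure of `∇` in `Lᵖ(μ)`. -/
def MemDp1 {d : ℕ} (p : ℝ≥0∞) (μ : Measure (WienerSpace d)) (φ : WienerSpace d → ℝ) : Prop :=
  ∃ D : WienerSpace d → CameronMartin d, IsGrossSobolevDeriv p μ φ D

/-! The inequality is proved for a centred Gaussian measure ν with the energy `2 ∫ secondMoment ν
(f' x)`, then transferred to cylindrical functions, then closed under limits. To keep logarithms
bounded, f² is replaced throughout by f² + η with η > 0.

The Gaussian case rests on self-similarity: if Y and Z are independent with law ν, then (Y + Z)/√2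
has law ν. Subadditivity of entropy (`entropy_prod_le`) therefore turns an inequality at scale s,
uniform in the base point x, for y ↦ f(x + s y), into one at scale √2 s with at most twice the
additive error (`entropy_smul_sqrt_two_le`). At small scale, a Taylor expansion gives the inequality
with error C s³ (`exists_entropy_smul_le`). Starting from s = 2^(-k/2), k doublings reach scale 1
with error 2^k C 2^(-3k/2) = C 2^(-k/2), which tends to 0. The sharp constant 2 is already present
in the Taylor expansion.

For a cylindrical F = f(w(t₁), …, w(tₙ)), the vector of values is centred Gaussian, and the Brownian
covariance min(s, t) is the inner product of the representers of evaluation in H. Hence the second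
moment of f' is exactly |∇F|² (`IsWienerMeasure.secondMoment_eq`). The passage to the limit uses
Fatou's lemma, because x log x is bounded below. -/

/-- The entropy `E[g log g] - E[g] log E[g]` of a function `g`. -/
noncomputable def entropy {Ω : Type*} [MeasurableSpace Ω] (μ : Measure Ω) (g : Ω → ℝ) : ℝ :=
  ∫ x, g x * Real.log (g x) ∂μ - (∫ x, g x ∂μ) * Real.log (∫ x, g x ∂μ)

/-! ### Entropy: variational bound and subadditivity -/

section Entropy

variable {Ω Ω' : Type*} [MeasurableSpace Ω] [MeasurableSpace Ω']

theorem integrable_of_mem_Icc {μ : Measure Ω} [IsFiniteMeasure μ] {g : Ω → ℝ} {a b : ℝ}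
    (hg : Measurable g) (h : ∀ x, g x ∈ Set.Icc a b) : Integrable g μ :=
  .of_mem_Icc a b hg.aemeasurable (.of_forall h)

theorem integral_mem_Icc {μ : Measure Ω} [IsProbabilityMeasure μ] {g : Ω → ℝ} {a b : ℝ}
    (hg : Measurable g) (h : ∀ x, g x ∈ Set.Icc a b) : ∫ x, g x ∂μ ∈ Set.Icc a b := by
  have hi := integrable_of_mem_Icc (μ := μ) hg h
  constructor
  · simpa using integral_mono (integrable_const a) hi fun x ↦ (h x).1
  · simpa using integral_mono hi (integrable_const b) fun x ↦ (h x).2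

theorem log_mem_Icc {a b x : ℝ} (ha : 0 < a) (hx : x ∈ Set.Icc a b) :
    Real.log x ∈ Set.Icc (Real.log a) (Real.log b) :=
  ⟨Real.log_le_log ha hx.1, Real.log_le_log (ha.trans_le hx.1) hx.2⟩

/-- A bounded positive function times the logarithm of another one is integrable. -/
theorem integrable_mul_log {μ : Measure Ω} [IsFiniteMeasure μ] {g k : Ω → ℝ} {a b : ℝ}
    (ha : 0 < a) (hg : Measurable g) (h : ∀ x, g x ∈ Set.Icc a b)
    (hk : Measurable k) (h' : ∀ x, k x ∈ Set.Icc a b) :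
    Integrable (fun x ↦ g x * Real.log (k x)) μ := by
  refine (integrable_of_mem_Icc (Real.measurable_log.comp hk)
    fun x ↦ log_mem_Icc ha (h' x)).bdd_mul (c := b) hg.aestronglyMeasurable (.of_forall fun x ↦ ?_)
  rw [Real.norm_eq_abs, abs_of_pos (ha.trans_le (h x).1)]
  exact (h x).2

/-- This is log t ≤ t - 1 at t = b/a, the pointwise form of Gibbs' inequality. -/
theorem mul_log_sub_le {a b : ℝ} (ha : 0 < a) (hb : 0 < b) :
    a * (Real.log b - Real.log a) ≤ b - a := by
  have h := Real.log_le_sub_one_of_pos (div_pos hb ha)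
  rw [Real.log_div hb.ne' ha.ne'] at h
  calc a * (Real.log b - Real.log a) ≤ a * (b / a - 1) := by gcongr
    _ = b - a := by field_simp

/-- Variational upper bound for the entropy. -/
theorem entropy_le_integral {μ : Measure Ω} [IsProbabilityMeasure μ] {g : Ω → ℝ} {a b c : ℝ}
    (ha : 0 < a) (hg : Measurable g) (h : ∀ x, g x ∈ Set.Icc a b) (hc : 0 < c) :
    entropy μ g ≤ ∫ x, (g x * Real.log (g x) - g x * Real.log c - g x + c) ∂μ := by
  have hi := integrable_of_mem_Icc (μ := μ) hg h
  have hl := integrable_mul_log (μ := μ) ha hg h hg h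
  have hM : 0 < ∫ x, g x ∂μ := ha.trans_le (integral_mem_Icc hg h).1
  rw [integral_add (by fun_prop) (by fun_prop), integral_sub (by fun_prop) hi,
    integral_sub hl (by fun_prop), integral_mul_const]
  -- With M = ∫ g, the right side exceeds the entropy by M log M - M log c - M + c, which is
  -- nonnegative.
  have := mul_log_sub_le hM hc
  simp only [entropy, integral_const, probReal_univ, smul_eq_mul]
  linarith

/-- Subadditivity of the entropy on a product space. -/
theorem entropy_prod_le {μ : Measure Ω} {ν : Measure Ω'} [IsProbabilityMeasure μ]
    [IsProbabilityMeasure ν] {g : Ω × Ω' → ℝ} {a b : ℝ} (ha : 0 < a) (hg : Measurable g)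
    (h : ∀ p, g p ∈ Set.Icc a b) :
    entropy (μ.prod ν) g ≤
      ∫ x, entropy ν (fun y ↦ g (x, y)) ∂μ + ∫ y, entropy μ (fun x ↦ g (x, y)) ∂ν := by
  set m₁ : Ω → ℝ := fun x ↦ ∫ y, g (x, y) ∂ν with hm₁
  set m₂ : Ω' → ℝ := fun y ↦ ∫ x, g (x, y) ∂μ with hm₂
  set M : ℝ := ∫ p, g p ∂(μ.prod ν) with hM
  have mm₁ : Measurable m₁ := hg.stronglyMeasurable.integral_prod_right'.measurable
  have mm₂ : Measurable m₂ := hg.stronglyMeasurable.integral_prod_left'.measurable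
  have b₁ : ∀ x, m₁ x ∈ Set.Icc a b := fun x ↦ integral_mem_Icc (by fun_prop) fun y ↦ h _
  have b₂ : ∀ y, m₂ y ∈ Set.Icc a b := fun y ↦ integral_mem_Icc (by fun_prop) fun x ↦ h _
  have bM : M ∈ Set.Icc a b := integral_mem_Icc hg h
  have hM0 : 0 < M := ha.trans_le bM.1
  have hi := integrable_of_mem_Icc (μ := μ.prod ν) hg h
  have il := integrable_mul_log (μ := μ.prod ν) ha hg h hg h
  have i₁ : Integrable (fun p : Ω × Ω' ↦ g p * Real.log (m₁ p.1)) (μ.prod ν) :=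
    integrable_mul_log ha hg h (by fun_prop) fun p ↦ b₁ p.1
  have i₂ : Integrable (fun p : Ω × Ω' ↦ g p * Real.log (m₂ p.2)) (μ.prod ν) :=
    integrable_mul_log ha hg h (by fun_prop) fun p ↦ b₂ p.2
  have im₁ : Integrable m₁ μ := integrable_of_mem_Icc mm₁ b₁
  have im₂ : Integrable m₂ ν := integrable_of_mem_Icc mm₂ b₂
  have im₁₂ : Integrable (fun p : Ω × Ω' ↦ m₁ p.1 * m₂ p.2) (μ.prod ν) := im₁.mul_prod im₂
  have e₁ : ∫ x, m₁ x ∂μ = M := (integral_prod _ hi).symm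
  have e₂ : ∫ y, m₂ y ∂ν = M := (integral_prod_symm _ hi).symm
  have E₁ : ∫ x, entropy ν (fun y ↦ g (x, y)) ∂μ =
      ∫ p, g p * Real.log (g p) ∂(μ.prod ν) - ∫ p, g p * Real.log (m₁ p.1) ∂(μ.prod ν) := by
    rw [← integral_sub il i₁, integral_prod _ (by fun_prop)]
    refine integral_congr_ae ?_
    refine .of_forall fun x ↦ ?_
    have hx : ∀ y, g (x, y) ∈ Set.Icc a b := fun y ↦ h _
    simp only [entropy]
    rw [integral_sub (integrable_mul_log ha (by fun_prop) hx (by fun_prop) hx)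
      ((integrable_of_mem_Icc (by fun_prop) hx).mul_const _), integral_mul_const]
  have E₂ : ∫ y, entropy μ (fun x ↦ g (x, y)) ∂ν =
      ∫ p, g p * Real.log (g p) ∂(μ.prod ν) - ∫ p, g p * Real.log (m₂ p.2) ∂(μ.prod ν) := by
    rw [← integral_sub il i₂, integral_prod_symm _ (by fun_prop)]
    refine integral_congr_ae ?_
    refine .of_forall fun y ↦ ?_
    have hx : ∀ x, g (x, y) ∈ Set.Icc a b := fun x ↦ h _
    simp only [entropy]
    rw [integral_sub (integrable_mul_log ha (by fun_prop) hx (by fun_prop) hx)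
      ((integrable_of_mem_Icc (by fun_prop) hx).mul_const _), integral_mul_const]
  -- Gibbs' inequality between g and the normalised product m₁ m₂ / M of its marginals. Both have
  -- total mass M, so the right side integrates to 0.
  have key : ∫ p, (g p * Real.log (m₁ p.1) + g p * Real.log (m₂ p.2) - g p * Real.log M
      - g p * Real.log (g p)) ∂(μ.prod ν) ≤ ∫ p, (m₁ p.1 * m₂ p.2 / M - g p) ∂(μ.prod ν) := by
    refine integral_mono (((i₁.add i₂).sub (hi.mul_const _)).sub il) ((im₁₂.div_const _).sub hi)
      fun p ↦ ?_
    have p₁ : 0 < m₁ p.1 := ha.trans_le (b₁ _).1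
    have p₂ : 0 < m₂ p.2 := ha.trans_le (b₂ _).1
    have := mul_log_sub_le (ha.trans_le (h p).1) (div_pos (mul_pos p₁ p₂) hM0)
    rw [Real.log_div (mul_pos p₁ p₂).ne' hM0.ne', Real.log_mul p₁.ne' p₂.ne'] at this
    linarith
  rw [integral_sub (by fun_prop) il, integral_sub (by fun_prop) (by fun_prop), integral_add i₁ i₂, integral_mul_const,
    integral_sub (im₁₂.div_const _) hi, integral_div, integral_prod_mul, e₁, e₂, ← hM,
    mul_div_cancel_right₀ _ hM0.ne'] at key
  rw [E₁, E₂, entropy, ← hM]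
  linarith

/-! ### Taylor bounds for relative entropy -/

/-- The difference of the two sides vanishes at 0 and has derivative x³/(1 + x), which has the sign
of x on (-1, ∞); so 0 is its minimum. -/
theorem log_one_add_le {t : ℝ} (ht : -1 < t) : Real.log (1 + t) ≤ t - t ^ 2 / 2 + t ^ 3 / 3 := by
  have hd : ∀ x, -1 < x → HasDerivAt
      (fun t : ℝ ↦ t - t ^ 2 / 2 + t ^ 3 / 3 - Real.log (1 + t)) (x ^ 3 / (1 + x)) x := by
    intro x hx
    have h1 : (1 + x) ≠ 0 := by linarith
    have := (((hasDerivAt_id x).sub (((hasDerivAt_id x).pow 2).div_const 2)).add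
      (((hasDerivAt_id x).pow 3).div_const 3)).sub (((hasDerivAt_id x).const_add 1).log h1)
    refine this.congr_deriv ?_
    simp only [id, Nat.cast_ofNat]
    field_simp
    ring
  suffices 0 ≤ t - t ^ 2 / 2 + t ^ 3 / 3 - Real.log (1 + t) by linarith
  rcases le_total 0 t with h0 | h0
  · have := monotoneOn_of_deriv_nonneg (convex_Ici (0 : ℝ))
      (f := fun t : ℝ ↦ t - t ^ 2 / 2 + t ^ 3 / 3 - Real.log (1 + t))
      (fun x hx ↦ (hd x (by linarith [Set.mem_Ici.1 hx])).continuousAt.continuousWithinAt)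
      (fun x hx ↦ by
        rw [interior_Ici] at hx
        exact (hd x (by linarith [Set.mem_Ioi.1 hx])).differentiableAt.differentiableWithinAt)
      (fun x hx ↦ by
        rw [interior_Ici] at hx
        have : 0 < x := hx
        rw [(hd x (by linarith)).deriv]
        positivity) Set.self_mem_Ici h0 h0
    simpa using this
  · have := antitoneOn_of_deriv_nonpos (convex_Ioc (-1 : ℝ) 0)
      (f := fun t : ℝ ↦ t - t ^ 2 / 2 + t ^ 3 / 3 - Real.log (1 + t))
      (fun x hx ↦ (hd x hx.1).continuousAt.continuousWithinAt)
      (fun x hx ↦ by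
        rw [interior_Ioc] at hx
        exact (hd x hx.1).differentiableAt.differentiableWithinAt)
      (fun x hx ↦ by
        rw [interior_Ioc] at hx
        rw [(hd x hx.1).deriv]
        refine div_nonpos_of_nonpos_of_nonneg ?_ (by linarith [hx.1])
        exact Odd.pow_nonpos (by decide) hx.2.le) ⟨ht, h0⟩ ⟨by norm_num, le_rfl⟩ h0
    simpa using this

/-- Multiply `log_one_add_le` at t = (a - b)/b by a = b(1 + t): the terms in t², t³ and t⁴ have
coefficients b/2, -b/6 and b/3. -/
theorem mul_log_sub_mul_log_le {a b : ℝ} (ha : 0 < a) (hb : 0 < b) :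
    a * Real.log a - a * Real.log b - a + b ≤
      (a - b) ^ 2 / (2 * b) + |a - b| ^ 3 / (6 * b ^ 2) + |a - b| ^ 4 / (3 * b ^ 3) := by
  have ht : -1 < (a - b) / b := by rw [lt_div_iff₀ hb]; linarith
  have h1 : 1 + (a - b) / b = a / b := by field_simp; ring
  have h := log_one_add_le ht
  rw [h1, Real.log_div ha.ne' hb.ne'] at h
  have h2 : a * Real.log a - a * Real.log b - a + b ≤
      a * ((a - b) / b - ((a - b) / b) ^ 2 / 2 + ((a - b) / b) ^ 3 / 3) - a + b := by
    have := mul_le_mul_of_nonneg_left h ha.le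
    linarith
  refine h2.trans ?_
  have h3 : a * ((a - b) / b - ((a - b) / b) ^ 2 / 2 + ((a - b) / b) ^ 3 / 3) - a + b =
      (a - b) ^ 2 / (2 * b) + (-(a - b) ^ 3) / (6 * b ^ 2) + (a - b) ^ 4 / (3 * b ^ 3) := by
    field_simp
    ring
  have h4 : -(a - b) ^ 3 ≤ |a - b| ^ 3 := by
    rw [← abs_pow]; exact neg_le_abs _
  rw [h3, ← abs_pow (a - b) 4, abs_of_nonneg (by positivity : 0 ≤ (a - b) ^ 4)]
  gcongr

/-- Relative entropy of `p² + η` with respect to `q² + η`, up to third order in `p - q`. -/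
theorem exists_mul_log_sub_le {M η : ℝ} (hM : 0 ≤ M) (hη : 0 < η) :
    ∃ K, 0 ≤ K ∧ ∀ p q : ℝ, |p| ≤ M → |q| ≤ M →
      (p ^ 2 + η) * Real.log (p ^ 2 + η) - (p ^ 2 + η) * Real.log (q ^ 2 + η)
        - (p ^ 2 + η) + (q ^ 2 + η) ≤ 2 * (p - q) ^ 2 + K * |p - q| ^ 3 := by
  -- One summand per term of `mul_log_sub_mul_log_le`, using |p² - q²| ≤ 2M|p - q| and denominators
  -- at least η. In the quartic term, the surplus factor |p - q| is bounded by 2M.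
  refine ⟨3 * M / η + (2 * M) ^ 3 / (6 * η ^ 2) + (2 * M) ^ 4 * (2 * M) / (3 * η ^ 3),
    by positivity, fun p q hp hq ↦ ?_⟩
  have ha : 0 < p ^ 2 + η := by positivity
  have hb : 0 < q ^ 2 + η := by positivity
  have hbη : η ≤ q ^ 2 + η := by linarith [sq_nonneg q]
  refine (mul_log_sub_mul_log_le ha hb).trans ?_
  have hs : |p + q| ≤ 2 * M := (abs_add_le _ _).trans (by linarith)
  have hu : |p - q| ≤ 2 * M := (abs_sub _ _).trans (by linarith)
  have hd : |p ^ 2 + η - (q ^ 2 + η)| ≤ 2 * M * |p - q| := by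
    rw [show p ^ 2 + η - (q ^ 2 + η) = (p + q) * (p - q) by ring, abs_mul]
    gcongr
  have h1 : (p ^ 2 + η - (q ^ 2 + η)) ^ 2 / (2 * (q ^ 2 + η)) ≤
      2 * (p - q) ^ 2 + 3 * M / η * |p - q| ^ 3 := by
    -- Here 4q² ≤ 4(q² + η) cancels the denominator 2(q² + η). This leaves 2(p - q)² with no
    -- dependence on η, the source of the sharp constant.
    have e : (p ^ 2 + η - (q ^ 2 + η)) ^ 2 =
        (p - q) ^ 2 * (4 * q ^ 2 + (4 * q + (p - q)) * (p - q)) := by ring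
    have hx : (4 * q + (p - q)) * (p - q) ≤ 6 * M * |p - q| := by
      refine (le_abs_self _).trans ?_
      rw [abs_mul]
      gcongr
      refine (abs_add_le _ _).trans ?_
      rw [abs_mul, abs_of_pos (by norm_num : (0 : ℝ) < 4)]
      linarith
    calc (p ^ 2 + η - (q ^ 2 + η)) ^ 2 / (2 * (q ^ 2 + η))
        ≤ (p - q) ^ 2 * (4 * (q ^ 2 + η) + 6 * M * |p - q|) / (2 * (q ^ 2 + η)) := by
          rw [e]
          gcongr
          linarith
      _ = 2 * (p - q) ^ 2 + 3 * M * |p - q| ^ 3 / (q ^ 2 + η) := by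
          have : |p - q| ^ 3 = (p - q) ^ 2 * |p - q| := by rw [pow_succ, sq_abs]
          rw [this]
          field_simp
          ring
      _ ≤ 2 * (p - q) ^ 2 + 3 * M * |p - q| ^ 3 / η := by gcongr
      _ = _ := by ring
  have h2 : |p ^ 2 + η - (q ^ 2 + η)| ^ 3 / (6 * (q ^ 2 + η) ^ 2) ≤
      (2 * M) ^ 3 / (6 * η ^ 2) * |p - q| ^ 3 := by
    calc _ ≤ (2 * M * |p - q|) ^ 3 / (6 * η ^ 2) := by gcongr
      _ = _ := by ring
  have h3 : |p ^ 2 + η - (q ^ 2 + η)| ^ 4 / (3 * (q ^ 2 + η) ^ 3) ≤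
      (2 * M) ^ 4 * (2 * M) / (3 * η ^ 3) * |p - q| ^ 3 := by
    calc _ ≤ (2 * M * |p - q|) ^ 4 / (3 * η ^ 3) := by gcongr
      _ = (2 * M) ^ 4 * |p - q| / (3 * η ^ 3) * |p - q| ^ 3 := by ring
      _ ≤ _ := by gcongr
  linarith

end Entropy

/-! ### Test functions with bounded Lipschitz derivative -/

section BoundedLipschitzFDeriv

variable {E : Type*} [NormedAddCommGroup E] [NormedSpace ℝ E]

/-- `f` is bounded and differentiable with derivative `f'`, which is bounded and Lipschitz; `M`
bounds all the constants involved. -/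
structure HasBoundedLipschitzFDeriv (f : E → ℝ) (f' : E → StrongDual ℝ E) (M : ℝ) : Prop where
  hasFDerivAt : ∀ x, HasFDerivAt f (f' x) x
  abs_le : ∀ x, |f x| ≤ M
  norm_fderiv_le : ∀ x, ‖f' x‖ ≤ M
  norm_fderiv_sub_le : ∀ x y, ‖f' x - f' y‖ ≤ M * ‖x - y‖

namespace HasBoundedLipschitzFDeriv

variable {f : E → ℝ} {f' : E → StrongDual ℝ E} {M : ℝ}

theorem nonneg (hf : HasBoundedLipschitzFDeriv f f' M) : 0 ≤ M :=
  (abs_nonneg _).trans (hf.abs_le 0)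

theorem continuous (hf : HasBoundedLipschitzFDeriv f f' M) : Continuous f :=
  continuous_iff_continuousAt.2 fun x ↦ (hf.hasFDerivAt x).continuousAt

theorem continuous_fderiv (hf : HasBoundedLipschitzFDeriv f f' M) : Continuous f' := by
  refine (LipschitzWith.of_dist_le_mul (K := .mk M hf.nonneg) fun x y ↦ ?_).continuous
  rw [dist_eq_norm, dist_eq_norm]
  exact hf.norm_fderiv_sub_le x y

theorem abs_sub_le (hf : HasBoundedLipschitzFDeriv f f' M) (x y : E) :
    |f (x + y) - f x| ≤ M * ‖y‖ := by
  simpa using convex_univ.norm_image_sub_le_of_norm_hasFDerivWithin_le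
    (fun z _ ↦ (hf.hasFDerivAt z).hasFDerivWithinAt) (fun z _ ↦ hf.norm_fderiv_le z)
    (Set.mem_univ x) (Set.mem_univ (x + y))

/-- Mean value inequality on the ball of radius ‖y‖ about x, where f' differs from f' x by at most
M‖y‖. -/
theorem abs_sub_sub_le (hf : HasBoundedLipschitzFDeriv f f' M) (x y : E) :
    |f (x + y) - f x - f' x y| ≤ M * ‖y‖ ^ 2 := by
  have h := (convex_closedBall x ‖y‖).norm_image_sub_le_of_norm_hasFDerivWithin_le'
    (C := M * ‖y‖) (φ := f' x) (x := x) (y := x + y)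
    (fun z _ ↦ (hf.hasFDerivAt z).hasFDerivWithinAt)
    (fun z hz ↦ (hf.norm_fderiv_sub_le z x).trans
      (mul_le_mul_of_nonneg_left (mem_closedBall_iff_norm.1 hz) hf.nonneg))
    (by simp) (by simp)
  rw [add_sub_cancel_left] at h
  calc |f (x + y) - f x - f' x y| ≤ M * ‖y‖ * ‖y‖ := h
    _ = M * ‖y‖ ^ 2 := by ring

end HasBoundedLipschitzFDeriv

end BoundedLipschitzFDeriv

/-! ### Second moments of linear forms and the small-scale inequality -/

section SecondMoment

variable {E : Type*} [NormedAddCommGroup E] [MeasurableSpace E]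

theorem integrable_norm_pow {ν : Measure E} [IsFiniteMeasure ν] {k : ℕ} (hk : k ≤ 3)
    (hν : MemLp id 3 ν) : Integrable (fun y : E ↦ ‖y‖ ^ k) ν := by
  have h : MemLp (id : E → E) k ν := hν.mono_exponent (by exact_mod_cast hk)
  exact h.integrable_norm_pow'

variable [NormedSpace ℝ E]

/-- The second moment of a continuous linear form. -/
noncomputable def secondMoment (ν : Measure E) (L : StrongDual ℝ E) : ℝ := ∫ y, (L y) ^ 2 ∂ν

theorem secondMoment_nonneg (ν : Measure E) (L : StrongDual ℝ E) : 0 ≤ secondMoment ν L :=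
  integral_nonneg fun _ ↦ sq_nonneg _

variable [BorelSpace E] {ν : Measure E} [IsFiniteMeasure ν]

theorem integrable_sq_dual (hν : MemLp id 3 ν) (L : StrongDual ℝ E) :
    Integrable (fun y ↦ (L y) ^ 2) ν := by
  refine ((integrable_norm_pow (k := 2) (by norm_num) hν).const_mul (‖L‖ ^ 2)).mono'
    (by fun_prop) (.of_forall fun y ↦ ?_)
  rw [norm_pow, ← mul_pow]
  gcongr
  exact L.le_opNorm y

/-- Factor L² - L'² = (L + L')(L - L') and bound the first factor by 2M‖y‖. -/
theorem secondMoment_sub_le (hν : MemLp id 3 ν) {L L' : StrongDual ℝ E} {M : ℝ}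
    (hL : ‖L‖ ≤ M) (hL' : ‖L'‖ ≤ M) :
    secondMoment ν L - secondMoment ν L' ≤ 2 * M * (∫ y, ‖y‖ ^ 2 ∂ν) * ‖L - L'‖ := by
  have hM : 0 ≤ M := (norm_nonneg L).trans hL
  rw [secondMoment, secondMoment, ← integral_sub (integrable_sq_dual hν L)
    (integrable_sq_dual hν L')]
  have hi := (integrable_norm_pow (k := 2) (by norm_num) hν).const_mul (2 * M * ‖L - L'‖)
  calc ∫ y, (L y ^ 2 - L' y ^ 2) ∂ν ≤ ∫ y, 2 * M * ‖L - L'‖ * ‖y‖ ^ 2 ∂ν := by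
        refine integral_mono ((integrable_sq_dual hν L).sub (integrable_sq_dual hν L')) hi
          fun y ↦ ?_
        have e : L y ^ 2 - L' y ^ 2 = ((L + L') y) * ((L - L') y) := by
          simp only [add_apply, sub_apply]; ring
        have h1 : ‖L + L'‖ ≤ 2 * M := (norm_add_le _ _).trans (by linarith)
        calc L y ^ 2 - L' y ^ 2 ≤ ‖((L + L') y) * ((L - L') y)‖ := by
              rw [e]; exact le_abs_self _
          _ ≤ (2 * M * ‖y‖) * (‖L - L'‖ * ‖y‖) := by
              rw [norm_mul]
              exact mul_le_mul ((L + L').le_of_opNorm_le h1 y) ((L - L').le_opNorm y)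
                (norm_nonneg _) (by positivity)
          _ = _ := by ring
    _ = _ := by rw [integral_const_mul]; ring

theorem secondMoment_le (hν : MemLp id 3 ν) {L : StrongDual ℝ E} {M : ℝ} (hL : ‖L‖ ≤ M) :
    secondMoment ν L ≤ 2 * M * (∫ y, ‖y‖ ^ 2 ∂ν) * M := by
  have hM : 0 ≤ M := (norm_nonneg L).trans hL
  have h0 : 0 ≤ ∫ y, ‖y‖ ^ 2 ∂ν := integral_nonneg fun _ ↦ by positivity
  have h := secondMoment_sub_le hν hL (L' := 0) (by simpa using hM)
  have h' : secondMoment ν (0 : StrongDual ℝ E) = 0 := by simp [secondMoment]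
  rw [h', sub_zero, sub_zero] at h
  exact h.trans (by gcongr)

variable {f : E → ℝ} {f' : E → StrongDual ℝ E} {M : ℝ}

theorem HasBoundedLipschitzFDeriv.continuous_secondMoment (hf : HasBoundedLipschitzFDeriv f f' M)
    (hν : MemLp id 3 ν) : Continuous fun x ↦ secondMoment ν (f' x) := by
  have hM := hf.nonneg
  have h0 : 0 ≤ ∫ y, ‖y‖ ^ 2 ∂ν := integral_nonneg fun _ ↦ by positivity
  refine (LipschitzWith.of_le_add_mul (.mk (2 * M * (∫ y, ‖y‖ ^ 2 ∂ν) * M) (by positivity))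
    fun x y ↦ ?_).continuous
  have h := secondMoment_sub_le hν (hf.norm_fderiv_le x) (hf.norm_fderiv_le y)
  have h2 : 2 * M * (∫ y, ‖y‖ ^ 2 ∂ν) * ‖f' x - f' y‖ ≤
      2 * M * (∫ y, ‖y‖ ^ 2 ∂ν) * (M * ‖x - y‖) := by
    gcongr
    exact hf.norm_fderiv_sub_le x y
  rw [dist_eq_norm]
  change _ ≤ _ + 2 * M * (∫ y, ‖y‖ ^ 2 ∂ν) * M * ‖x - y‖
  linarith

/-- Log-Sobolev inequality at a small scale `s`, with an error of order `s³`. -/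
theorem HasBoundedLipschitzFDeriv.exists_entropy_smul_le [IsProbabilityMeasure ν]
    (hf : HasBoundedLipschitzFDeriv f f' M) (hν : MemLp id 3 ν) {η : ℝ} (hη : 0 < η) :
    ∃ C, ∀ (x : E) (s : ℝ), 0 ≤ s →
      entropy ν (fun y ↦ f (x + s • y) ^ 2 + η) ≤
        s ^ 2 * ∫ z, 2 * secondMoment ν (f' (x + s • z)) ∂ν + C * s ^ 3 := by
  have hM := hf.nonneg
  obtain ⟨K, hK, hKf⟩ := exists_mul_log_sub_le hM hη
  set m₁ := ∫ y, ‖y‖ ∂ν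
  set m₂ := ∫ y, ‖y‖ ^ 2 ∂ν with hm₂
  set m₃ := ∫ y, ‖y‖ ^ 3 ∂ν with hm₃
  have hm₂0 : 0 ≤ m₂ := integral_nonneg fun _ ↦ by positivity
  -- The term 4M² comes from linearising the squared increment of f, and KM³ from the cubic
  -- remainder of `exists_mul_log_sub_le`. The last summand pays for replacing the second moment at
  -- x by its average over x + s z.
  refine ⟨(4 * M ^ 2 + K * M ^ 3) * m₃ + 2 * (2 * M * m₂ * M) * m₁, fun x s hs ↦ ?_⟩
  have fcont := hf.continuous
  have i1 : Integrable (fun y : E ↦ ‖y‖) ν := by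
    simpa using integrable_norm_pow (k := 1) (by norm_num) hν
  have i2 := integrable_norm_pow (ν := ν) (k := 2) (by norm_num) hν
  have i3 := integrable_norm_pow (ν := ν) (k := 3) (by norm_num) hν
  have isq := integrable_sq_dual hν (f' x)
  have hmeas : Measurable fun y ↦ f (x + s • y) ^ 2 + η := by fun_prop
  have hbd : ∀ y, f (x + s • y) ^ 2 + η ∈ Set.Icc η (M ^ 2 + η) := fun y ↦
    ⟨by linarith [sq_nonneg (f (x + s • y))],
      by linarith [sq_le_sq.2 ((hf.abs_le (x + s • y)).trans (le_abs_self M))]⟩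
  have hcpos : 0 < f x ^ 2 + η := by positivity
  -- The variational bound is used with c = f(x)² + η, so that only increments of f from x enter.
  have step1 : entropy ν (fun y ↦ f (x + s • y) ^ 2 + η) ≤
      2 * s ^ 2 * secondMoment ν (f' x) + (4 * M ^ 2 + K * M ^ 3) * s ^ 3 * m₃ := by
    refine (entropy_le_integral hη hmeas hbd hcpos).trans ?_
    have hR : Integrable (fun y ↦ 2 * s ^ 2 * (f' x y) ^ 2 +
        (4 * M ^ 2 + K * M ^ 3) * s ^ 3 * ‖y‖ ^ 3) ν := by fun_prop
    have hL : Integrable (fun y ↦ (f (x + s • y) ^ 2 + η) * Real.log (f (x + s • y) ^ 2 + η) -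
        (f (x + s • y) ^ 2 + η) * Real.log (f x ^ 2 + η) - (f (x + s • y) ^ 2 + η) +
        (f x ^ 2 + η)) ν := by
      have := integrable_mul_log (μ := ν) hη hmeas hbd hmeas hbd
      have := integrable_of_mem_Icc (μ := ν) hmeas hbd
      fun_prop
    refine (integral_mono hL hR fun y ↦ ?_).trans_eq ?_
    · refine (hKf _ _ (hf.abs_le _) (hf.abs_le _)).trans ?_
      set u := f (x + s • y) - f x
      have hsy : ‖s • y‖ = s * ‖y‖ := by rw [norm_smul, Real.norm_of_nonneg hs]
      have hu : |u| ≤ M * (s * ‖y‖) := hsy ▸ hf.abs_sub_le x (s • y)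
      have hv : |u - s * f' x y| ≤ M * (s * ‖y‖) ^ 2 := by
        have := hf.abs_sub_sub_le x (s • y)
        rwa [hsy, map_smul, smul_eq_mul] at this
      have hw : |s * f' x y| ≤ M * (s * ‖y‖) := by
        rw [abs_mul, abs_of_nonneg hs]
        have := (f' x).le_of_opNorm_le (hf.norm_fderiv_le x) y
        rw [Real.norm_eq_abs] at this
        calc s * |f' x y| ≤ s * (M * ‖y‖) := by gcongr
          _ = _ := by ring
      have h2 : u ^ 2 ≤ (s * f' x y) ^ 2 + 2 * M ^ 2 * (s * ‖y‖) ^ 3 := by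
        have e : u ^ 2 - (s * f' x y) ^ 2 = (u - s * f' x y) * (u + s * f' x y) := by ring
        have : (u - s * f' x y) * (u + s * f' x y) ≤
            (M * (s * ‖y‖) ^ 2) * (2 * (M * (s * ‖y‖))) := by
          refine (le_abs_self _).trans ?_
          rw [abs_mul]
          gcongr
          exact (abs_add_le _ _).trans (by linarith)
        nlinarith
      have h3 : |u| ^ 3 ≤ (M * (s * ‖y‖)) ^ 3 := by gcongr
      calc 2 * u ^ 2 + K * |u| ^ 3
          ≤ 2 * ((s * f' x y) ^ 2 + 2 * M ^ 2 * (s * ‖y‖) ^ 3) + K * (M * (s * ‖y‖)) ^ 3 := by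
            gcongr
        _ = _ := by ring
    · rw [integral_add (by fun_prop) (by fun_prop), integral_const_mul, integral_const_mul,
        secondMoment]
  have hQc := hf.continuous_secondMoment hν
  have iQ : Integrable (fun z ↦ secondMoment ν (f' (x + s • z))) ν :=
    integrable_of_mem_Icc (hQc.measurable.comp (by fun_prop : Measurable fun z ↦ x + s • z))
      fun z ↦ ⟨secondMoment_nonneg _ _, secondMoment_le hν (hf.norm_fderiv_le _)⟩
  have step2 : secondMoment ν (f' x) ≤
      ∫ z, secondMoment ν (f' (x + s • z)) ∂ν + 2 * M * m₂ * M * s * m₁ := by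
    rw [← integral_const_mul, ← integral_add iQ (by fun_prop)]
    have : ∫ _, secondMoment ν (f' x) ∂ν = secondMoment ν (f' x) := by simp
    rw [← this]
    refine integral_mono (by fun_prop) (by fun_prop) fun z ↦ ?_
    have h := secondMoment_sub_le hν (hf.norm_fderiv_le x) (hf.norm_fderiv_le (x + s • z))
    have h2 : ‖f' x - f' (x + s • z)‖ ≤ M * (s * ‖z‖) := by
      refine (hf.norm_fderiv_sub_le _ _).trans_eq ?_
      rw [sub_add_cancel_left, norm_neg, norm_smul, Real.norm_of_nonneg hs]
    have h3 : 2 * M * m₂ * ‖f' x - f' (x + s • z)‖ ≤ 2 * M * m₂ * (M * (s * ‖z‖)) := by gcongr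
    linarith
  rw [integral_const_mul]
  have := mul_le_mul_of_nonneg_left step2 (by positivity : 0 ≤ 2 * s ^ 2)
  nlinarith

end SecondMoment

/-! ### Logarithmic Sobolev inequality for centred Gaussian measures -/

section GaussianLogSobolev

variable {E : Type*} [NormedAddCommGroup E] [NormedSpace ℝ E] [MeasurableSpace E] [BorelSpace E]
  [SecondCountableTopology E]

theorem entropy_map {Ω Ω' : Type*} [MeasurableSpace Ω] [MeasurableSpace Ω'] {μ : Measure Ω}
    {X : Ω → Ω'} (hX : Measurable X) {g : Ω' → ℝ} (hg : Measurable g) :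
    entropy (μ.map X) g = entropy μ (g ∘ X) := by
  unfold entropy
  rw [integral_map hX.aemeasurable (by fun_prop : Measurable fun x ↦ g x * Real.log (g x)).aestronglyMeasurable,
    integral_map hX.aemeasurable hg.aestronglyMeasurable]
  rfl

/-- The map is the first component of the rotation of E × E by π/4, which preserves ν ⊗ ν. -/
theorem IsGaussian.map_add_smul_eq_self [CompleteSpace E] (ν : Measure E) [IsGaussian ν]
    (h0 : ν[id] = 0) :
    (ν.prod ν).map (fun p : E × E ↦ (√2 / 2) • (p.1 + p.2)) = ν := by
  have h := IsGaussian.map_rotation_eq_self h0 (Real.pi / 4)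
  have e : (fun p : E × E ↦ (√2 / 2) • (p.1 + p.2)) =
      Prod.fst ∘ ContinuousLinearMap.rotation (Real.pi / 4) := by
    ext p
    simp [ContinuousLinearMap.rotation_apply]
  rw [e, ← Measure.map_map measurable_fst (by fun_prop), h, Measure.map_fst_prod]
  simp

/-- Doubling the variance doubles the defect in a log-Sobolev inequality. -/
theorem entropy_smul_sqrt_two_le {ν : Measure E} [IsProbabilityMeasure ν]
    (hν : (ν.prod ν).map (fun p : E × E ↦ (√2 / 2) • (p.1 + p.2)) = ν) {g G : E → ℝ}
    (hg : Measurable g) (hG : Measurable G) {a b c d : ℝ} (ha : 0 < a)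
    (hgab : ∀ x, g x ∈ Set.Icc a b) (hGcd : ∀ x, G x ∈ Set.Icc c d) {s δ : ℝ}
    (h : ∀ x, entropy ν (fun y ↦ g (x + s • y)) ≤ s ^ 2 * ∫ y, G (x + s • y) ∂ν + δ) (x : E) :
    entropy ν (fun y ↦ g (x + (√2 * s) • y)) ≤
      (√2 * s) ^ 2 * ∫ y, G (x + (√2 * s) • y) ∂ν + 2 * δ := by
  have hX : Measurable fun p : E × E ↦ (√2 / 2) • (p.1 + p.2) := by fun_prop
  have e : ∀ p : E × E, x + (√2 * s) • (√2 / 2) • (p.1 + p.2) = x + s • p.1 + s • p.2 := by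
    intro p
    rw [smul_smul, show √2 * s * (√2 / 2) = √2 * √2 / 2 * s by ring,
      Real.mul_self_sqrt (by norm_num), smul_add, ← add_assoc]
    norm_num
  have e1 : entropy ν (fun y ↦ g (x + (√2 * s) • y)) =
      entropy (ν.prod ν) (fun p ↦ g (x + s • p.1 + s • p.2)) := by
    conv_lhs => rw [← hν]
    rw [entropy_map hX (by fun_prop)]
    congr 1
    ext p
    exact congrArg g (e p)
  have iG : Integrable (fun p : E × E ↦ G (x + s • p.1 + s • p.2)) (ν.prod ν) :=
    integrable_of_mem_Icc (by fun_prop) fun _ ↦ hGcd _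
  have e2 : ∫ y, G (x + (√2 * s) • y) ∂ν = ∫ p, G (x + s • p.1 + s • p.2) ∂(ν.prod ν) := by
    conv_lhs => rw [← hν]
    rw [integral_map hX.aemeasurable (Measurable.aestronglyMeasurable (by fun_prop))]
    simp only [e]
  have hgm : Measurable fun p : E × E ↦ g (x + s • p.1 + s • p.2) := by fun_prop
  have hp := entropy_prod_le (μ := ν) (ν := ν) ha hgm fun p ↦ hgab _
  have hent : ∀ {k : E × E → ℝ}, Measurable k → (∀ p, k p ∈ Set.Icc a b) →
      Integrable (fun x ↦ entropy ν fun y ↦ k (x, y)) ν := by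
    intro k hk hkab
    have hk1 := integrable_of_mem_Icc (μ := ν.prod ν) hk hkab
    have m1 : Measurable fun x ↦ ∫ y, k (x, y) ∂ν :=
      hk.stronglyMeasurable.integral_prod_right'.measurable
    have b1 : ∀ x, ∫ y, k (x, y) ∂ν ∈ Set.Icc a b :=
      fun x ↦ integral_mem_Icc (by fun_prop) fun y ↦ hkab _
    exact (integrable_mul_log (μ := ν.prod ν) ha hk hkab hk hkab).integral_prod_left.sub
      (integrable_mul_log ha m1 b1 m1 b1)
  -- With y frozen, the function of z is again at scale s but based at x + s y; this is why the
  -- hypothesis must hold at every base point. The other variable is symmetric.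
  have b1 : ∫ y, entropy ν (fun z ↦ g (x + s • y + s • z)) ∂ν ≤
      s ^ 2 * ∫ p, G (x + s • p.1 + s • p.2) ∂(ν.prod ν) + δ := by
    have i := iG.integral_prod_left
    rw [integral_prod _ iG, ← integral_const_mul]
    have : ∫ _, δ ∂ν = δ := by simp
    conv_rhs => rw [← this]
    rw [← integral_add (by fun_prop) (by fun_prop)]
    exact integral_mono (hent hgm fun p ↦ hgab _) (by fun_prop) fun y ↦ h (x + s • y)
  have b2 : ∫ z, entropy ν (fun y ↦ g (x + s • y + s • z)) ∂ν ≤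
      s ^ 2 * ∫ p, G (x + s • p.1 + s • p.2) ∂(ν.prod ν) + δ := by
    have i := iG.integral_prod_right
    rw [integral_prod_symm _ iG, ← integral_const_mul]
    have : ∫ _, δ ∂ν = δ := by simp
    conv_rhs => rw [← this]
    rw [← integral_add (by fun_prop) (by fun_prop)]
    refine integral_mono (hent (hgm.comp measurable_swap) fun p ↦ hgab _) (by fun_prop)
      fun z ↦ ?_
    simpa only [add_right_comm] using h (x + s • z)
  rw [e1, e2, mul_pow, Real.sq_sqrt (by norm_num)]
  linarith

/-- Logarithmic Sobolev inequality for a centred Gaussian measure. -/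
theorem HasBoundedLipschitzFDeriv.entropy_le [CompleteSpace E] {ν : Measure E} [IsGaussian ν]
    (h0 : ν[id] = 0) {f : E → ℝ} {f' : E → StrongDual ℝ E} {M : ℝ}
    (hf : HasBoundedLipschitzFDeriv f f' M) {η : ℝ} (hη : 0 < η) :
    entropy ν (fun x ↦ f x ^ 2 + η) ≤ 2 * ∫ x, secondMoment ν (f' x) ∂ν := by
  have hν : MemLp id 3 ν := IsGaussian.memLp_id ν 3 (by norm_num)
  obtain ⟨C, hC⟩ := hf.exists_entropy_smul_le hν hη
  have fc := hf.continuous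
  have hQ := (hf.continuous_secondMoment hν).measurable
  have key : ∀ (k : ℕ) (δ s : ℝ), (∀ x, entropy ν (fun y ↦ f (x + s • y) ^ 2 + η) ≤
      s ^ 2 * ∫ z, 2 * secondMoment ν (f' (x + s • z)) ∂ν + δ) →
      ∀ x, entropy ν (fun y ↦ f (x + (√2 ^ k * s) • y) ^ 2 + η) ≤
      (√2 ^ k * s) ^ 2 * ∫ z, 2 * secondMoment ν (f' (x + (√2 ^ k * s) • z)) ∂ν + 2 ^ k * δ := by
    intro k
    induction k with
    | zero => intro δ s h; simpa using h
    | succ k ih =>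
      intro δ s h x
      have := entropy_smul_sqrt_two_le (IsGaussian.map_add_smul_eq_self ν h0)
        (g := fun x ↦ f x ^ 2 + η) (G := fun x ↦ 2 * secondMoment ν (f' x)) (by fun_prop)
        (by fun_prop) (a := η) (b := M ^ 2 + η) (c := 0)
        (d := 2 * (2 * M * (∫ y, ‖y‖ ^ 2 ∂ν) * M)) hη
        (fun y ↦ ⟨by linarith [sq_nonneg (f y)],
          by linarith [sq_le_sq.2 ((hf.abs_le y).trans (le_abs_self M))]⟩)
        (fun y ↦ ⟨by linarith [secondMoment_nonneg ν (f' y)],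
          by linarith [secondMoment_le hν (hf.norm_fderiv_le y)]⟩) (ih δ s h) x
      simpa only [pow_succ', mul_assoc] using this
  -- Start at scale 2^(-k/2) and double the variance k times. The cubic error outweighs the factor
  -- 2^k, leaving C 2^(-k/2).
  have hle : ∀ k : ℕ, entropy ν (fun x ↦ f x ^ 2 + η) ≤
      2 * ∫ x, secondMoment ν (f' x) ∂ν + C * ((√2)⁻¹) ^ k := by
    intro k
    have h := key k _ ((√2)⁻¹ ^ k) (fun x ↦ hC x ((√2)⁻¹ ^ k) (by positivity)) 0
    have hs : √2 ^ k * (√2)⁻¹ ^ k = 1 := by rw [← mul_pow, mul_inv_cancel₀ (by positivity), one_pow]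
    have h2 : (2 : ℝ) ^ k * (C * ((√2)⁻¹ ^ k) ^ 3) = C * ((√2)⁻¹) ^ k := by
      have : (2 : ℝ) ^ k = (√2 ^ k) ^ 2 := by
        rw [← pow_mul, mul_comm, pow_mul, Real.sq_sqrt (by norm_num)]
      rw [this]
      calc _ = C * (√2 ^ k * (√2)⁻¹ ^ k) ^ 2 * (√2)⁻¹ ^ k := by ring
        _ = _ := by rw [hs]; ring
    simpa only [hs, h2, integral_const_mul, zero_add, one_smul, one_pow, one_mul] using h
  have hlim : Tendsto (fun k : ℕ ↦ 2 * ∫ x, secondMoment ν (f' x) ∂ν + C * ((√2)⁻¹) ^ k) atTop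
      (𝓝 (2 * ∫ x, secondMoment ν (f' x) ∂ν + C * 0)) := by
    refine tendsto_const_nhds.add (tendsto_const_nhds.mul
      (tendsto_pow_atTop_nhds_zero_of_lt_one (by positivity) ?_))
    exact inv_lt_one_of_one_lt₀ (by rw [Real.lt_sqrt (by norm_num)]; norm_num)
  rw [mul_zero, add_zero] at hlim
  exact ge_of_tendsto' hlim hle

end GaussianLogSobolev

/-- The unweighted seminorms of orders 0, 1 and 2 bound f, f' and f''; the last gives the Lipschitz
bound by the mean value inequality. -/
theorem SchwartzMap.exists_hasBoundedLipschitzFDeriv {E : Type*} [NormedAddCommGroup E]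
    [NormedSpace ℝ E] (f : 𝓢(E, ℝ)) :
    ∃ M, HasBoundedLipschitzFDeriv f (fderiv ℝ f) M := by
  set s : ℕ → ℝ := fun k ↦ SchwartzMap.seminorm ℝ 0 k f
  have hs : ∀ k, 0 ≤ s k := fun k ↦ apply_nonneg _ _
  have h : ∀ k x, ‖iteratedFDeriv ℝ k f x‖ ≤ s k := fun k x ↦
    SchwartzMap.norm_iteratedFDeriv_le_seminorm ℝ f k x
  have hd : Differentiable ℝ (fderiv ℝ f) :=
    ((f.smooth 2).fderiv_right (m := 1) (by norm_num)).differentiable (by norm_num)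
  have hd2 : ∀ x, ‖fderiv ℝ (fderiv ℝ f) x‖ ≤ s 2 := by
    intro x
    rw [← norm_iteratedFDeriv_one, norm_iteratedFDeriv_fderiv]
    exact h 2 x
  refine ⟨s 0 + s 1 + s 2, fun x ↦ f.differentiableAt.hasFDerivAt, fun x ↦ ?_, fun x ↦ ?_,
    fun x y ↦ ?_⟩
  · have := h 0 x
    rw [norm_iteratedFDeriv_zero, Real.norm_eq_abs] at this
    linarith [hs 1, hs 2]
  · have := h 1 x
    rw [norm_iteratedFDeriv_one] at this
    linarith [hs 0, hs 2]
  · have := convex_univ.norm_image_sub_le_of_norm_fderiv_le (fun z _ ↦ hd z)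
      (fun z _ ↦ hd2 z) (Set.mem_univ y) (Set.mem_univ x)
    refine this.trans ?_
    gcongr
    linarith [hs 0, hs 1]

/-! ### Cylindrical functions on Wiener space -/

section Wiener

variable {d : ℕ}

/-- Evaluation of a path at finitely many times. -/
def WienerSpace.evalAt {n : ℕ} (t : Fin n → I) (w : WienerSpace d) :
    Fin n → EuclideanSpace ℝ (Fin d) := fun k ↦ w.1 (t k)

theorem WienerSpace.continuous_evalAt {n : ℕ} (t : Fin n → I) :
    Continuous (WienerSpace.evalAt (d := d) t) :=
  continuous_pi fun k ↦ (continuous_eval_const (t k)).comp continuous_subtype_val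

theorem WienerSpace.measurable_evalAt {n : ℕ} (t : Fin n → I) :
    Measurable (WienerSpace.evalAt (d := d) t) :=
  (WienerSpace.continuous_evalAt t).measurable

/-- The basis vector of `(ℝᵈ)ⁿ` in direction `i` at position `k`. -/
noncomputable def coordVec {n d : ℕ} (q : Fin n × Fin d) : Fin n → EuclideanSpace ℝ (Fin d) :=
  Pi.single q.1 (EuclideanSpace.single q.2 1)

theorem sum_coordVec {n : ℕ} (x : Fin n → EuclideanSpace ℝ (Fin d)) :
    ∑ q : Fin n × Fin d, x q.1 q.2 • coordVec q = x := by
  ext k i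
  simp [coordVec, Fintype.sum_prod_type, Finset.sum_apply, Pi.single_apply]

theorem dual_apply_eq_sum {n : ℕ} (L : StrongDual ℝ (Fin n → EuclideanSpace ℝ (Fin d)))
    (x : Fin n → EuclideanSpace ℝ (Fin d)) :
    L x = ∑ q : Fin n × Fin d, L (coordVec q) * x q.1 q.2 := by
  conv_lhs => rw [← sum_coordVec x, map_sum]
  simp [mul_comm]

/-- The element of the Cameron–Martin space representing `h ↦ hᵢ(t)`. -/
noncomputable def CameronMartin.coord (t : I) (i : Fin d) : CameronMartin d :=
  indicatorConstLp 2 (measurableSet_Iic (a := t)) (measure_ne_top volume _)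
    (EuclideanSpace.single i 1)

theorem CameronMartin.inner_coord (t : I) (i : Fin d) (h : CameronMartin d) :
    inner ℝ (CameronMartin.coord t i) h = h.path.1 t i := by
  rw [CameronMartin.coord, L2.inner_indicatorConstLp_eq_inner_setIntegral,
    EuclideanSpace.inner_single_left]
  simp [CameronMartin.path]

/-- The indicators of [0, s] and [0, t] overlap in length min(s, t). So the Brownian covariance is
the Gram matrix of the representers. -/
theorem CameronMartin.inner_coord_coord (s t : I) (i j : Fin d) :
    inner ℝ (CameronMartin.coord s i) (CameronMartin.coord t j) =
      if i = j then ((min s t : I) : ℝ) else 0 := by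
  rw [CameronMartin.coord, CameronMartin.coord, L2.inner_indicatorConstLp_indicatorConstLp,
    Set.Iic_inter_Iic, Measure.real, unitInterval.volume_Iic,
    ENNReal.toReal_ofReal unitInterval.nonneg']
  by_cases h : i = j <;> simp [h, EuclideanSpace.inner_single_left]

/-- Along w + r h, F is f on a straight line in finite dimension. The chain rule gives the inner
product of D w with every h, which determines D w. -/
theorem IsCameronMartinGradient.eq_sum {F : WienerSpace d → ℝ} {D : WienerSpace d → CameronMartin d}
    (hD : IsCameronMartinGradient F D) {n : ℕ} {t : Fin n → I}
    {f : (Fin n → EuclideanSpace ℝ (Fin d)) → ℝ} (hf : Differentiable ℝ f)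
    (hF : ∀ w, F w = f (WienerSpace.evalAt t w)) (w : WienerSpace d) :
    D w = ∑ q : Fin n × Fin d,
      fderiv ℝ f (WienerSpace.evalAt t w) (coordVec q) • CameronMartin.coord (t q.1) q.2 := by
  refine ext_inner_right ℝ fun h ↦ ?_
  have h1 : HasDerivAt (fun r : ℝ ↦ WienerSpace.evalAt t w + r • WienerSpace.evalAt t h.path) (WienerSpace.evalAt t h.path) 0 := by
    simpa using ((hasDerivAt_id (0 : ℝ)).smul_const (WienerSpace.evalAt t h.path)).const_add (WienerSpace.evalAt t w)
  have h2 : HasFDerivAt f (fderiv ℝ f (WienerSpace.evalAt t w)) (WienerSpace.evalAt t w + (0 : ℝ) • WienerSpace.evalAt t h.path) := by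
    simpa using (hf (WienerSpace.evalAt t w)).hasFDerivAt
  have h3 := h2.comp_hasDerivAt (0 : ℝ) h1
  have h4 : (fun r : ℝ ↦ F (w + r • h.path)) =
      f ∘ fun r : ℝ ↦ WienerSpace.evalAt t w + r • WienerSpace.evalAt t h.path := by
    ext r
    rw [hF]
    rfl
  rw [← h4] at h3
  rw [(hD w h).unique h3, dual_apply_eq_sum, sum_inner]
  refine Finset.sum_congr rfl fun q _ ↦ ?_
  rw [real_inner_smul_left, CameronMartin.inner_coord]
  rfl

variable {μ : Measure (WienerSpace d)}

theorem IsWienerMeasure.isProbabilityMeasure (hμ : IsWienerMeasure μ) : IsProbabilityMeasure μ :=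
  hμ.isGaussianProcess.isProbabilityMeasure

theorem IsWienerMeasure.isGaussian_map (hμ : IsWienerMeasure μ) {n : ℕ} (t : Fin n → I) :
    IsGaussian (μ.map (WienerSpace.evalAt t)) := by
  classical
  -- The Gaussian property concerns finite sets of indices, whereas the times may repeat. S merges
  -- repetitions and L copies the coordinates back.
  let S : Finset (I × Fin d) := Finset.univ.image fun q : Fin n × Fin d ↦ (t q.1, q.2)
  let L : (S → ℝ) →L[ℝ] Fin n → EuclideanSpace ℝ (Fin d) :=
    ∑ q : Fin n × Fin d, (ContinuousLinearMap.proj (R := ℝ) (φ := fun _ : S ↦ ℝ)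
      ⟨(t q.1, q.2), Finset.mem_image_of_mem _ (Finset.mem_univ q)⟩).smulRight (coordVec q)
  have h := (hμ.isGaussianProcess.hasGaussianLaw S).map L
  have e : L ∘ (fun w : WienerSpace d ↦ S.restrict fun q : I × Fin d ↦ w.1 q.1 q.2) =
      WienerSpace.evalAt t := by
    ext1 w
    rw [← sum_coordVec (WienerSpace.evalAt t w)]
    simp [L, WienerSpace.evalAt]
  rw [e] at h
  exact h.isGaussian_map

theorem IsWienerMeasure.memLp_eval (hμ : IsWienerMeasure μ) (t : I) (i : Fin d) :
    MemLp (fun w : WienerSpace d ↦ w.1 t i) 2 μ :=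
  (hμ.isGaussianProcess.hasGaussianLaw_eval (t, i)).memLp_two

theorem IsWienerMeasure.integral_map_evalAt (hμ : IsWienerMeasure μ) {n : ℕ} (t : Fin n → I) :
    (μ.map (WienerSpace.evalAt t))[id] = 0 := by
  have := hμ.isProbabilityMeasure
  have hm : Measurable (WienerSpace.evalAt (d := d) t) := WienerSpace.measurable_evalAt t
  rw [integral_map hm.aemeasurable (by fun_prop)]
  calc ∫ w, WienerSpace.evalAt t w ∂μ
      = ∫ w : WienerSpace d, ∑ q : Fin n × Fin d, w.1 (t q.1) q.2 • coordVec q ∂μ :=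
        integral_congr_ae (.of_forall fun w ↦ (sum_coordVec _).symm)
    _ = 0 := by
        rw [integral_finsetSum _ fun q _ ↦
          ((hμ.memLp_eval (t q.1) q.2).integrable (by norm_num)).smul_const _]
        simp_rw [integral_smul_const, hμ.integral_eval]
        simp

/-- Both sides are the same quadratic form in the coefficients of L, since covariances of path
coordinates equal inner products of their representers. With L = f', this turns Gaussian energy into
|∇F|². -/
theorem IsWienerMeasure.secondMoment_eq (hμ : IsWienerMeasure μ) {n : ℕ} (t : Fin n → I)
    (L : StrongDual ℝ (Fin n → EuclideanSpace ℝ (Fin d))) :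
    secondMoment (μ.map (WienerSpace.evalAt t)) L =
      ‖∑ q : Fin n × Fin d, L (coordVec q) • CameronMartin.coord (t q.1) q.2‖ ^ 2 := by
  have := hμ.isProbabilityMeasure
  have hcov : ∀ p q : Fin n × Fin d,
      ∫ w : WienerSpace d, w.1 (t p.1) p.2 * w.1 (t q.1) q.2 ∂μ =
        inner ℝ (CameronMartin.coord (t p.1) p.2) (CameronMartin.coord (t q.1) q.2) := by
    intro p q
    have h := hμ.covariance_eval (t p.1) (t q.1) p.2 q.2
    rw [covariance_eq_sub (hμ.memLp_eval _ _) (hμ.memLp_eval _ _), hμ.integral_eval, zero_mul,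
      sub_zero] at h
    rw [CameronMartin.inner_coord_coord, ← h]
    rfl
  have hi : ∀ p q : Fin n × Fin d,
      Integrable (fun w : WienerSpace d ↦ w.1 (t p.1) p.2 * w.1 (t q.1) q.2) μ :=
    fun p q ↦ (hμ.memLp_eval _ _).integrable_mul (hμ.memLp_eval _ _)
  have e : ∀ w, L (WienerSpace.evalAt t w) ^ 2 = ∑ p : Fin n × Fin d, ∑ q : Fin n × Fin d,
      L (coordVec p) * (L (coordVec q) * (w.1 (t p.1) p.2 * w.1 (t q.1) q.2)) := by
    intro w
    rw [dual_apply_eq_sum L, sq, Finset.sum_mul_sum]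
    refine Finset.sum_congr rfl fun p _ ↦ Finset.sum_congr rfl fun q _ ↦ ?_
    simp only [WienerSpace.evalAt]
    ring
  rw [secondMoment, integral_map (WienerSpace.measurable_evalAt t).aemeasurable
    (by fun_prop), ← real_inner_self_eq_norm_sq, sum_inner]
  simp_rw [inner_sum, real_inner_smul_left, real_inner_smul_right, ← hcov, e]
  rw [integral_finsetSum _ fun p _ ↦ integrable_finsetSum _ fun q _ ↦
    ((hi p q).const_mul _).const_mul _]
  refine Finset.sum_congr rfl fun p _ ↦ ?_
  rw [integral_finsetSum _ fun q _ ↦ ((hi p q).const_mul _).const_mul _]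
  refine Finset.sum_congr rfl fun q _ ↦ ?_
  rw [← integral_const_mul, ← integral_const_mul]

/-- Logarithmic Sobolev inequality for cylindrical functions. -/
theorem IsCylindrical.entropy_le (hμ : IsWienerMeasure μ) {F : WienerSpace d → ℝ}
    {D : WienerSpace d → CameronMartin d} (hF : IsCylindrical F)
    (hD : IsCameronMartinGradient F D) {η : ℝ} (hη : 0 < η) :
    entropy μ (fun w ↦ F w ^ 2 + η) ≤ 2 * ∫ w, ‖D w‖ ^ 2 ∂μ := by
  obtain ⟨n, t, f, hf⟩ := hF
  obtain ⟨M, hM⟩ := f.exists_hasBoundedLipschitzFDeriv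
  have hm : Measurable (WienerSpace.evalAt (d := d) t) := WienerSpace.measurable_evalAt t
  have hG := hμ.isGaussian_map t
  have hQ := hM.continuous_secondMoment (IsGaussian.memLp_id (μ.map (WienerSpace.evalAt t)) 3
    (by norm_num))
  have fc := f.continuous
  have h := hM.entropy_le (hμ.integral_map_evalAt t) hη
  rw [entropy_map hm (by fun_prop), integral_map hm.aemeasurable
    hQ.measurable.aestronglyMeasurable] at h
  convert h using 4
  · exact congrArg (fun r ↦ r ^ 2 + η) (hf _)
  · rw [hμ.secondMoment_eq, hD.eq_sum f.differentiable hf]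

theorem IsCylindrical.measurable {F : WienerSpace d → ℝ} (hF : IsCylindrical F) :
    Measurable F := by
  obtain ⟨n, t, f, hf⟩ := hF
  rw [show F = f ∘ WienerSpace.evalAt t from funext hf]
  exact f.continuous.measurable.comp (WienerSpace.measurable_evalAt t)

theorem IsCylindrical.exists_abs_le {F : WienerSpace d → ℝ} (hF : IsCylindrical F) :
    ∃ M, ∀ w, |F w| ≤ M := by
  obtain ⟨n, t, f, hf⟩ := hF
  obtain ⟨M, hM⟩ := f.exists_hasBoundedLipschitzFDeriv
  exact ⟨M, fun w ↦ hf w ▸ hM.abs_le _⟩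

theorem IsCylindrical.stronglyMeasurable_gradient {F : WienerSpace d → ℝ}
    {D : WienerSpace d → CameronMartin d} (hF : IsCylindrical F)
    (hD : IsCameronMartinGradient F D) : StronglyMeasurable D := by
  obtain ⟨n, t, f, hf⟩ := hF
  obtain ⟨M, hM⟩ := f.exists_hasBoundedLipschitzFDeriv
  rw [show D = _ from funext fun w ↦ hD.eq_sum f.differentiable hf w]
  refine Finset.stronglyMeasurable_fun_sum _ fun q _ ↦ ?_
  have hc : Continuous fun x ↦ fderiv ℝ f x (coordVec q) :=
    hM.continuous_fderiv.clm_apply continuous_const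
  exact (hc.measurable.comp (WienerSpace.measurable_evalAt t)).stronglyMeasurable.smul_const _

end Wiener

/-! ### Fatou's lemma and convergence of squared norms -/

section Limit

variable {Ω : Type*} [MeasurableSpace Ω] {μ : Measure Ω}

/-- Fatou's lemma for nonnegative real functions with convergent bounds on their integrals. -/
theorem integrable_and_integral_le_of_tendsto_ae {u : ℕ → Ω → ℝ} {v : Ω → ℝ} {R : ℕ → ℝ} {r : ℝ}
    (hu : ∀ k, Integrable (u k) μ) (hu0 : ∀ k x, 0 ≤ u k x) (hv : AEStronglyMeasurable v μ)
    (hlim : ∀ᵐ x ∂μ, Tendsto (fun k ↦ u k x) atTop (𝓝 (v x)))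
    (hR : ∀ k, ∫ x, u k x ∂μ ≤ R k) (hRr : Tendsto R atTop (𝓝 r)) :
    Integrable v μ ∧ ∫ x, v x ∂μ ≤ r := by
  have hv0 : 0 ≤ᵐ[μ] v := by
    filter_upwards [hlim] with x hx
    exact ge_of_tendsto' hx fun k ↦ hu0 k x
  have hr : 0 ≤ r := ge_of_tendsto' hRr fun k ↦ (integral_nonneg (hu0 k)).trans (hR k)
  have hle : ∫⁻ x, ENNReal.ofReal (v x) ∂μ ≤ ENNReal.ofReal r := by
    calc ∫⁻ x, ENNReal.ofReal (v x) ∂μ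
        = ∫⁻ x, liminf (fun k ↦ ENNReal.ofReal (u k x)) atTop ∂μ := by
          refine lintegral_congr_ae ?_
          filter_upwards [hlim] with x hx
          exact ((ENNReal.continuous_ofReal.tendsto _).comp hx).liminf_eq.symm
      _ ≤ liminf (fun k ↦ ∫⁻ x, ENNReal.ofReal (u k x) ∂μ) atTop :=
          lintegral_liminf_le' fun k ↦ (hu k).aestronglyMeasurable.aemeasurable.ennreal_ofReal
      _ ≤ liminf (fun k ↦ ENNReal.ofReal (R k)) atTop := by
          refine liminf_le_liminf (.of_forall fun k ↦ ?_)
          rw [← ofReal_integral_eq_lintegral_ofReal (hu k) (.of_forall (hu0 k))]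
          exact ENNReal.ofReal_le_ofReal (hR k)
      _ = ENNReal.ofReal r := ((ENNReal.continuous_ofReal.tendsto _).comp hRr).liminf_eq
  constructor
  · refine ⟨hv, ?_⟩
    rw [hasFiniteIntegral_iff_ofReal hv0]
    exact hle.trans_lt ENNReal.ofReal_lt_top
  · rw [integral_eq_lintegral_of_nonneg_ae hv0 hv]
    exact ENNReal.toReal_le_of_le_ofReal hr hle

variable {B : Type*} [NormedAddCommGroup B]

theorem integral_norm_sq_eq_toReal_eLpNorm {u : Ω → B} (hu : AEStronglyMeasurable u μ) :
    ∫ x, ‖u x‖ ^ 2 ∂μ = (eLpNorm u 2 μ).toReal ^ 2 := by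
  have h := eLpNorm_nnreal_pow_eq_lintegral (f := u) (μ := μ) (p := 2) (by norm_num)
  have h' : eLpNorm u 2 μ ^ 2 = ∫⁻ x, ‖u x‖ₑ ^ 2 ∂μ := by
    simpa only [NNReal.coe_ofNat, ENNReal.rpow_ofNat, ENNReal.coe_ofNat] using h
  rw [← ENNReal.toReal_pow, h', integral_eq_lintegral_of_nonneg_ae
    (.of_forall fun _ ↦ by positivity) (by fun_prop)]
  congr 1
  refine lintegral_congr fun x ↦ ?_
  rw [ENNReal.ofReal_pow (norm_nonneg _), ofReal_norm]

theorem tendsto_integral_norm_sq {u : ℕ → Ω → B} {v : Ω → B}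
    (hu : ∀ k, AEStronglyMeasurable (u k) μ) (hv : MemLp v 2 μ)
    (h : Tendsto (fun k ↦ eLpNorm (u k - v) 2 μ) atTop (𝓝 0)) :
    Tendsto (fun k ↦ ∫ x, ‖u k x‖ ^ 2 ∂μ) atTop (𝓝 (∫ x, ‖v x‖ ^ 2 ∂μ)) := by
  simp_rw [integral_norm_sq_eq_toReal_eLpNorm (hu _), integral_norm_sq_eq_toReal_eLpNorm hv.1]
  refine ((ENNReal.tendsto_toReal hv.2.ne).comp ?_).pow 2
  have lower : Tendsto (fun k ↦ eLpNorm v 2 μ - eLpNorm (u k - v) 2 μ) atTop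
      (𝓝 (eLpNorm v 2 μ)) := by
    simpa using ENNReal.Tendsto.sub tendsto_const_nhds h (.inl hv.2.ne)
  have upper : Tendsto (fun k ↦ eLpNorm (u k - v) 2 μ + eLpNorm v 2 μ) atTop
      (𝓝 (eLpNorm v 2 μ)) := by
    simpa using h.add tendsto_const_nhds
  refine tendsto_of_tendsto_of_tendsto_of_le_of_le lower upper (fun k ↦ ?_) fun k ↦ ?_
  · rw [tsub_le_iff_right]
    have := eLpNorm_sub_le (hu k) ((hu k).sub hv.1) (p := 2) (by norm_num)
    rwa [sub_sub_cancel] at this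
  · have := eLpNorm_add_le ((hu k).sub hv.1) hv.1 (p := 2) (by norm_num)
    rwa [sub_add_cancel] at this

end Limit

/-! ### Extension from cylindrical functions to the Sobolev space -/

/-- Gibbs' inequality against 1 gives x log x ≥ x - 1. The crude lower bound -1 suffices for Fatou's
lemma on a probability space. -/
theorem mul_log_add_one_nonneg {x : ℝ} (hx : 0 ≤ x) : 0 ≤ x * Real.log x + 1 := by
  rcases hx.eq_or_lt with rfl | h
  · simp
  · have := mul_log_sub_le h one_pos
    rw [Real.log_one] at this
    linarith

/-- Logarithmic Sobolev inequality on the Wiener space, for a given Gross–Sobolev derivative. -/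
theorem IsGrossSobolevDeriv.integrable_and_integral_le {d : ℕ} {μ : Measure (WienerSpace d)}
    (hμ : IsWienerMeasure μ) {φ : WienerSpace d → ℝ} {D : WienerSpace d → CameronMartin d}
    (h : IsGrossSobolevDeriv 2 μ φ D) :
    Integrable (fun w ↦ φ w ^ 2 * Real.log (φ w ^ 2)) μ ∧
      ∫ w, φ w ^ 2 * Real.log (φ w ^ 2) ∂μ ≤
        (∫ w, φ w ^ 2 ∂μ) * Real.log (∫ w, φ w ^ 2 ∂μ) + 2 * ∫ w, ‖D w‖ ^ 2 ∂μ := by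
  have := hμ.isProbabilityMeasure
  obtain ⟨hφ, hD, F, DF, hF, hDF, hlimF, hlimD⟩ := h
  have hFm : ∀ n, AEStronglyMeasurable (F n) μ := fun n ↦ (hF n).measurable.aestronglyMeasurable
  obtain ⟨ns, hns, hae⟩ := (tendstoInMeasure_of_tendsto_eLpNorm (by norm_num) hFm
    hφ.1 hlimF).exists_seq_tendsto_ae
  have hsqF := (tendsto_integral_norm_sq hFm hφ hlimF).comp hns.tendsto_atTop
  have hsqD := (tendsto_integral_norm_sq (fun n ↦
    ((hF n).stronglyMeasurable_gradient (hDF n)).aestronglyMeasurable) hD hlimD).comp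
    hns.tendsto_atTop
  simp only [Real.norm_eq_abs, sq_abs] at hsqF
  -- The regularisation η = 1/(k + 1) disappears along the same subsequence that gives almost sure
  -- convergence.
  have hη : Tendsto (fun k : ℕ ↦ 1 / ((k : ℝ) + 1)) atTop (𝓝 0) :=
    tendsto_one_div_add_atTop_nhds_zero_nat
  have hη0 : ∀ k : ℕ, 0 < 1 / ((k : ℝ) + 1) := fun k ↦ by positivity
  set g : ℕ → WienerSpace d → ℝ := fun k w ↦ F (ns k) w ^ 2 + 1 / ((k : ℝ) + 1) with hg
  have hgm : ∀ k, Measurable (g k) := fun k ↦ ((hF (ns k)).measurable.pow_const 2).add_const _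
  have hgb : ∀ k : ℕ, ∃ b, ∀ w, g k w ∈ Set.Icc (1 / ((k : ℝ) + 1)) b := by
    intro k
    obtain ⟨M, hM⟩ := (hF (ns k)).exists_abs_le
    exact ⟨M ^ 2 + 1 / ((k : ℝ) + 1), fun w ↦ ⟨by simp only [hg]; linarith [sq_nonneg (F (ns k) w)],
      by simp only [hg]; linarith [sq_le_sq.2 ((hM w).trans (le_abs_self M))]⟩⟩
  have hgl : ∀ k, Integrable (fun w ↦ g k w * Real.log (g k w)) μ := by
    intro k
    obtain ⟨b, hb⟩ := hgb k
    exact integrable_mul_log (hη0 k) (hgm k) hb (hgm k) hb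
  have hgint : Tendsto (fun k ↦ ∫ w, g k w ∂μ) atTop (𝓝 (∫ w, φ w ^ 2 ∂μ)) := by
    have h1 := hsqF.add hη
    rw [add_zero] at h1
    refine h1.congr fun k ↦ ?_
    obtain ⟨b, hb⟩ := hgb k
    have hi : Integrable (fun w ↦ F (ns k) w ^ 2) μ := by
      have := (integrable_of_mem_Icc (μ := μ) (hgm k) hb).sub
        (integrable_const (1 / ((k : ℝ) + 1)))
      refine this.congr (.of_forall fun w ↦ ?_)
      simp [hg]
    simp only [hg, Function.comp_apply]
    rw [integral_add hi (integrable_const _)]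
    simp
  -- The added 1 makes the integrands nonnegative. Fatou then yields both integrability and the
  -- bound, while the right sides converge by L² convergence of F and its gradient and continuity of
  -- x log x, including at 0.
  have key := integrable_and_integral_le_of_tendsto_ae (μ := μ)
    (u := fun k w ↦ g k w * Real.log (g k w) + 1)
    (v := fun w ↦ φ w ^ 2 * Real.log (φ w ^ 2) + 1)
    (R := fun k ↦ (∫ w, g k w ∂μ) * Real.log (∫ w, g k w ∂μ) +
      2 * ∫ w, ‖DF (ns k) w‖ ^ 2 ∂μ + 1)
    (r := (∫ w, φ w ^ 2 ∂μ) * Real.log (∫ w, φ w ^ 2 ∂μ) + 2 * ∫ w, ‖D w‖ ^ 2 ∂μ + 1)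
    (fun k ↦ (hgl k).add (integrable_const _))
    (fun k w ↦ mul_log_add_one_nonneg (by
      obtain ⟨b, hb⟩ := hgb k
      exact (hη0 k).le.trans (hb w).1))
    (((Real.continuous_mul_log.comp_aestronglyMeasurable (hφ.1.pow 2))).add
      aestronglyMeasurable_const)
    (by
      filter_upwards [hae] with w hw
      have : Tendsto (fun k ↦ g k w) atTop (𝓝 (φ w ^ 2)) := by
        simpa only [add_zero] using (hw.pow 2).add hη
      exact ((Real.continuous_mul_log.tendsto _).comp this).add_const 1)
    (fun k ↦ by
      have := (hF (ns k)).entropy_le hμ (hDF (ns k)) (hη0 k)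
      rw [entropy] at this
      rw [integral_add (hgl k) (integrable_const _)]
      simp only [integral_const, probReal_univ, smul_eq_mul, mul_one]
      linarith)
    ((((Real.continuous_mul_log.tendsto _).comp hgint).add (hsqD.const_mul 2)).add_const 1)
  obtain ⟨hi, hle⟩ := key
  have hi' : Integrable (fun w ↦ φ w ^ 2 * Real.log (φ w ^ 2)) μ := by
    refine (hi.sub (integrable_const (1 : ℝ))).congr (.of_forall fun w ↦ ?_)
    exact add_sub_cancel_right _ _
  refine ⟨hi', ?_⟩
  rw [integral_add hi' (integrable_const _)] at hle
  simpa using hle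

theorem mainTheorem3 {d : ℕ} (μ : Measure (WienerSpace d)) (hμ : IsWienerMeasure μ)
    (φ : WienerSpace d → ℝ) (hφ : MemDp1 2 μ φ) :
    Integrable (fun w ↦ φ w ^ 2 * Real.log (φ w ^ 2)) μ ∧
      ∀ Dφ : WienerSpace d → CameronMartin d, IsGrossSobolevDeriv 2 μ φ Dφ →
        ∫ w, φ w ^ 2 * Real.log (φ w ^ 2) ∂μ ≤
          (∫ w, φ w ^ 2 ∂μ) * Real.log (∫ w, φ w ^ 2 ∂μ) + 2 * ∫ w, ‖Dφ w‖ ^ 2 ∂μ := by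
  obtain ⟨D, hD⟩ := hφ
  exact ⟨(hD.integrable_and_integral_le hμ).1, fun Dφ hDφ ↦ (hDφ.integrable_and_integral_le hμ).2⟩
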